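/- For an integer $N\ge 2$ let $\Pi_N$ be the graph whose vertices are the classes $[\lambda,\mu]=\{\pm(\lambda,\mu)\}$ of pairs $(\lambda,\mu)\in\mathbb Z_N\times\mathbb Z_N$ with $\gcd(\lambda,\mu,N)=1$, where $[\lambda,\mu]$ and $[\nu,\omega]$ are adjacent if and only if $\lambda\omega-\mu\nu=\pm1$ in $\mathbb Z_N$. Let $\Pi_N'$ be the subgraph of $\Pi_N$ induced on the vertices that are not of the form $[\lambda,0]$. Let $p$ be an odd prime. If $p\ge 5$, then both $\Pi_p$ and $\Pi_p'$ have diameter $3$ (for $p=3$ both have diameter $1$). The graph $\Pi_p$ is $p$-regular and has vertex connectivity $p$; the graph $\Pi_p'$ is $(p-1)$-regular and has vertex connectivity $p-1$. (The vertex connectivity of a finite graph is the largest $k$ such that the graph has more than $k$ vertices and stays connected whenever fewer than $k$ vertices are removed.) Moreover, the spectrum of the adjacency matrix of $\Pi_p'$ consists of (i) $p-1$ with multiplicity $1$, (ii) $-1$ with multiplicity $p-1$, (iii) $0$ with multiplicity $(p-3)/2$, and (iv) $\sqrt p$ and $-\sqrt p$, each with multiplicity $(p-1)(p-3)/4$,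 where multiplicity $0$ means that the number is not an eigenvalue. In particular, $\Pi_p'$ is a Ramanujan graph: it is connected and $(p-1)$-regular, and every eigenvalue $\mu$ with $|\mu|\neq p-1$ satisfies $|\mu|\le 2\sqrt{p-2}$. -/

import Mathlib

/-! Platonic graphs, vertex connectivity, adjacency spectrum, Ramanujan graphs. -/

namespace Platonic

/-- Pairs `(a, b)` over `ℤ/N` with `gcd(a, b, N) = 1`. -/
abbrev Primitive (N : ℕ) : Type :=
  {v : ZMod N × ZMod N // Nat.gcd (Nat.gcd v.1.val v.2.val) N = 1}

/-- Two primitive pairs are identified when they agree up to a common sign. -/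
def signSetoid (N : ℕ) : Setoid (Primitive N) where
  r v w := v.1 = w.1 ∨ v.1 = -w.1
  iseqv :=
    { refl := fun _ => Or.inl rfl
      symm := by
        rintro v w (h | h)
        · exact Or.inl h.symm
        · exact Or.inr (by rw [h, neg_neg])
      trans := by
        rintro u v w (h | h) (h' | h')
        · exact Or.inl (h.trans h')
        · exact Or.inr (h.trans h')
        · exact Or.inr (by rw [h, h'])
        · exact Or.inl (by rw [h, h', neg_neg]) }

/-- The vertices `[a, b] = {± (a, b)}` of the Platonic graph. -/
def Vertex (N : ℕ) : Type := Quotient (signSetoid N)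

instance (N : ℕ) [NeZero N] : Finite (Vertex N) :=
  inferInstanceAs (Finite (Quotient (signSetoid N)))

noncomputable instance (N : ℕ) [NeZero N] : Fintype (Vertex N) := Fintype.ofFinite _

/-- The determinant of the matrix with columns `v` and `w`. -/
def det {N : ℕ} (v w : Primitive N) : ZMod N := v.1.1 * w.1.2 - v.1.2 * w.1.1

/-- Adjacency: the determinant of representatives is `± 1`. -/
def VertexAdj {N : ℕ} : Vertex N → Vertex N → Prop :=
  Quotient.lift₂ (s₁ := signSetoid N) (s₂ := signSetoid N)
    (fun v w => det v w = 1 ∨ det v w = -1) (by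
      have key : ∀ v w v' w' : Primitive N, (v.1 = v'.1 ∨ v.1 = -v'.1) →
          (w.1 = w'.1 ∨ w.1 = -w'.1) → det v w = det v' w' ∨ det v w = -det v' w' := by
        rintro v w v' w' (hv | hv) (hw | hw)
        · left; simp only [det, hv, hw]
        · right; simp only [det, hv, hw, Prod.fst_neg, Prod.snd_neg]; ring
        · right; simp only [det, hv, hw, Prod.fst_neg, Prod.snd_neg]; ring
        · left; simp only [det, hv, hw, Prod.fst_neg, Prod.snd_neg]; ring
      intro v w v' w' hv hw
      rcases key v w v' w' hv hw with h | h
      · simp only [h]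
      · simp only [h, neg_eq_iff_eq_neg, neg_neg]
        exact propext or_comm)

/-- The Platonic graph `Π_N`, for `N ≥ 2`. -/
def graph (N : ℕ) [Fact (1 < N)] : SimpleGraph (Vertex N) where
  Adj := VertexAdj
  symm := ⟨by
    intro x y
    induction x using Quotient.inductionOn
    induction y using Quotient.inductionOn
    rename_i v w
    change (det v w = 1 ∨ det v w = -1) → (det w v = 1 ∨ det w v = -1)
    have h : det w v = -det v w := by simp only [det]; ring
    rw [h, neg_inj, neg_eq_iff_eq_neg]
    exact Or.symm⟩
  loopless := ⟨by
    intro x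
    induction x using Quotient.inductionOn
    rename_i v
    change ¬ (det v v = 1 ∨ det v v = -1)
    have h : det v v = 0 := by simp only [det]; ring
    rw [h]
    rintro (h | h)
    · exact zero_ne_one h
    · exact zero_ne_one (neg_eq_zero.mp h.symm).symm⟩

/-- The principal axis: all vertices of the form `[a, 0]`. -/
def principalAxis (N : ℕ) : Set (Vertex N) :=
  {x | ∃ v : Primitive N, v.1.2 = 0 ∧ Quotient.mk (signSetoid N) v = x}

/-- The vertices of `Π_N` off the principal axis. -/
abbrev Vertex' (N : ℕ) : Type := {x : Vertex N // x ∈ (principalAxis N)ᶜ}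

noncomputable instance (N : ℕ) [NeZero N] : Fintype (Vertex' N) := Fintype.ofFinite _

/-- The modified Platonic graph `Π'_N`: the subgraph of `Π_N` induced on the complement of the
principal axis. -/
def graph' (N : ℕ) [Fact (1 < N)] : SimpleGraph (Vertex' N) :=
  (graph N).induce (principalAxis N)ᶜ

section Graphs

variable {V : Type*} [Fintype V]

/-- `G` is `k`-vertex-connected: it has more than `k` vertices, and it stays connected whenever
fewer than `k` vertices are removed. -/
def IsVertexConnected (G : SimpleGraph V) (k : ℕ) : Prop :=
  k < Fintype.card V ∧ ∀ S : Finset V, S.card < k → (G.induce {v | v ∉ S}).Connected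

/-- The vertex connectivity of a finite graph: the largest `k` for which it is
`k`-vertex-connected (such `k` are smaller than the number of vertices). -/
noncomputable def vertexConnectivity (G : SimpleGraph V) : ℕ :=
  sSup {k | IsVertexConnected G k}

open Classical in
/-- Every vertex of `G` has exactly `k` neighbours. -/
def IsRegular (G : SimpleGraph V) (k : ℕ) : Prop := G.IsRegularOfDegree k

open Classical in
/-- The adjacency operator on functions on the vertices. -/
noncomputable def adjacencyOperator (G : SimpleGraph V) : Module.End ℝ (V → ℝ) :=
  (G.adjMatrix ℝ).mulVecLin

/-- The multiplicity of `μ` as an eigenvalue of `G` (zero if it is not an eigenvalue). The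
adjacency operator is symmetric, so algebraic and geometric multiplicity agree. -/
noncomputable def multiplicity (G : SimpleGraph V) (μ : ℝ) : ℕ :=
  Module.finrank ℝ ((adjacencyOperator G).eigenspace μ)

/-- `G` is a Ramanujan graph of valence `k`: it is connected and `k`-regular, and every eigenvalue
`μ` of absolute value other than `k` satisfies `|μ| ≤ 2 √(k - 1)`. -/
def IsRamanujan (G : SimpleGraph V) (k : ℕ) : Prop :=
  G.Connected ∧ IsRegular G k ∧
    ∀ μ : ℝ, (adjacencyOperator G).HasEigenvalue μ → |μ| ≠ k → |μ| ≤ 2 * √((k : ℝ) - 1)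

end Graphs

end Platonic

/-! Everything is read off the determinant pairing on `𝔽_p²`. If `pairing v e = 1`, the neighbours
of `[v]` are the classes of the affine line `s • v + e`; for odd `p` no two of its points agree up
to sign, so there are `p` of them. Taking `e` on the principal axis, the neighbours off the axis are
those with `s ≠ 0`.

Diameter: vectors with nonzero pairing have the common neighbour `(v + w) / pairing v w`; parallel
ones need one extra step (`exists_walk`, `exists_walk'`). For `p ≠ 3`, `[0, 1]` and `[0, 2]` are at
distance three.

Connectivity: deleting all neighbours of a vertex isolates it, so the valence is an upper bound.
Conversely, if too few vertices are deleted, one of the `p` lines through the origin other than the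
axis stays intact. Every remaining vertex not on that line is adjacent to a vertex on it, and two
distinct vertices of one line are joined by as many disjoint paths of length three as the valence
(`exists_avoiding_pair`).

Spectrum: the vertices of `Π'_p` form a grid: `p` lines through the origin against `(p - 1) / 2`
heights (second coordinates up to sign). With `J` the all-ones matrix and `K`, `C` the matrices of
"same line" and "same height", counting neighbours gives `A J = (p - 1) J`, `A K = J - K`, `A C = 2
J` and `A² = p + 2 J - 2 K - C`. So `A` is `p - 1` on constants, `-1` on sum-zero functions of the
line, `0` on sum-zero functions of the height, and `A² = p` on the rest. The spectral projections
are thus explicit, and their traces are the multiplicities. -/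

namespace Platonic

open Finset

/-! ### The determinant pairing -/

section Pairing

variable {p : ℕ}

/-- The determinant pairing on `𝔽_p²`. -/
def pairing (v w : ZMod p × ZMod p) : ZMod p := v.1 * w.2 - v.2 * w.1

theorem pairing_self (v : ZMod p × ZMod p) : pairing v v = 0 := by
  simp only [pairing]; ring

theorem pairing_swap (v w : ZMod p × ZMod p) : pairing w v = -pairing v w := by
  simp only [pairing]; ring

theorem pairing_neg_left (v w : ZMod p × ZMod p) : pairing (-v) w = -pairing v w := by
  simp only [pairing, Prod.fst_neg, Prod.snd_neg]; ring

theorem pairing_neg_right (v w : ZMod p × ZMod p) : pairing v (-w) = -pairing v w := by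
  simp only [pairing, Prod.fst_neg, Prod.snd_neg]; ring

theorem pairing_smul_left (s : ZMod p) (v w : ZMod p × ZMod p) :
    pairing (s • v) w = s * pairing v w := by
  simp only [pairing, Prod.smul_fst, Prod.smul_snd, smul_eq_mul]; ring

theorem pairing_smul_right (s : ZMod p) (v w : ZMod p × ZMod p) :
    pairing v (s • w) = s * pairing v w := by
  simp only [pairing, Prod.smul_fst, Prod.smul_snd, smul_eq_mul]; ring

theorem pairing_add_left (u v w : ZMod p × ZMod p) :
    pairing (u + v) w = pairing u w + pairing v w := by
  simp only [pairing, Prod.fst_add, Prod.snd_add]; ring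

theorem pairing_add_right (u v w : ZMod p × ZMod p) :
    pairing u (v + w) = pairing u v + pairing u w := by
  simp only [pairing, Prod.fst_add, Prod.snd_add]; ring

theorem pairing_zero_right (v : ZMod p × ZMod p) : pairing v 0 = 0 := by
  simp [pairing]

/-- Cramer's rule. -/
theorem eq_smul_add_smul {v e : ZMod p × ZMod p} (h : pairing v e = 1) (w : ZMod p × ZMod p) :
    w = pairing w e • v + pairing v w • e := by
  simp only [pairing] at h ⊢
  ext
  · simp only [Prod.fst_add, Prod.smul_fst, smul_eq_mul]; linear_combination (-w.1) * h
  · simp only [Prod.snd_add, Prod.smul_snd, smul_eq_mul]; linear_combination (-w.2) * h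

end Pairing

/-! ### Vertices as nonzero vectors up to sign -/

section Basics

variable {p : ℕ} [Fact p.Prime]

theorem exists_pairing_eq_one {v : ZMod p × ZMod p} (hv : v ≠ 0) : ∃ e, pairing v e = 1 := by
  by_cases h : v.1 = 0
  · have h2 : v.2 ≠ 0 := fun h2 => hv (Prod.ext h h2)
    exact ⟨(-v.2⁻¹, 0), by simp [pairing, h2]⟩
  · exact ⟨(0, v.1⁻¹), by simp [pairing, h]⟩

theorem exists_smul_of_pairing_eq_zero {v w : ZMod p × ZMod p} (hv : v ≠ 0)
    (h : pairing v w = 0) : ∃ c : ZMod p, w = c • v := by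
  obtain ⟨e, he⟩ := exists_pairing_eq_one hv
  exact ⟨pairing w e, by simpa [h] using eq_smul_add_smul he w⟩

theorem gcd_val_eq_one_iff (v : ZMod p × ZMod p) :
    Nat.gcd (Nat.gcd v.1.val v.2.val) p = 1 ↔ v ≠ 0 := by
  have hp : p.Prime := Fact.out
  rw [← Nat.coprime_iff_gcd_eq_one, Nat.coprime_comm, hp.coprime_iff_not_dvd, Nat.dvd_gcd_iff,
    ← ZMod.natCast_eq_zero_iff, ← ZMod.natCast_eq_zero_iff, ZMod.natCast_zmod_val,
    ZMod.natCast_zmod_val, not_iff_not, Prod.ext_iff]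
  rfl

/-- The vertex `[v]` of a nonzero vector `v`. -/
def mk (v : ZMod p × ZMod p) (hv : v ≠ 0) : Vertex p :=
  Quotient.mk (signSetoid p) ⟨v, (gcd_val_eq_one_iff v).2 hv⟩

/-- A chosen representative of a vertex. -/
noncomputable def rep (x : Vertex p) : ZMod p × ZMod p := (Quotient.out (s := signSetoid p) x).1

theorem rep_ne_zero (x : Vertex p) : rep x ≠ 0 :=
  (gcd_val_eq_one_iff _).1 (Quotient.out (s := signSetoid p) x).2

theorem mk_rep (x : Vertex p) : mk (rep x) (rep_ne_zero x) = x :=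
  Quotient.out_eq (s := signSetoid p) x

theorem mk_eq_mk {v w : ZMod p × ZMod p} {hv : v ≠ 0} {hw : w ≠ 0} :
    mk v hv = mk w hw ↔ v = w ∨ v = -w :=
  Quotient.eq (r := signSetoid p)

theorem rep_mk (v : ZMod p × ZMod p) (hv : v ≠ 0) : rep (mk v hv) = v ∨ rep (mk v hv) = -v :=
  (mk_eq_mk (hv := rep_ne_zero _) (hw := hv)).1 (mk_rep _)

theorem eq_iff_rep {x y : Vertex p} : x = y ↔ rep x = rep y ∨ rep x = -rep y := by
  conv_lhs => rw [← mk_rep x, ← mk_rep y]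
  exact mk_eq_mk

theorem adj_mk {v w : ZMod p × ZMod p} {hv : v ≠ 0} {hw : w ≠ 0} :
    (graph p).Adj (mk v hv) (mk w hw) ↔ pairing v w = 1 ∨ pairing v w = -1 := Iff.rfl

theorem adj_iff_rep {x y : Vertex p} :
    (graph p).Adj x y ↔ pairing (rep x) (rep y) = 1 ∨ pairing (rep x) (rep y) = -1 := by
  conv_lhs => rw [← mk_rep x, ← mk_rep y]
  exact adj_mk

theorem mk_mem_principalAxis {v : ZMod p × ZMod p} {hv : v ≠ 0} :
    mk v hv ∈ principalAxis p ↔ v.2 = 0 := by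
  constructor
  · rintro ⟨w, hw, h⟩
    rcases (Quotient.eq (r := signSetoid p)).1 h with h | h
    · have h' : w.1 = v := h
      rw [← h', hw]
    · have h' : w.1 = -v := h
      rw [h'] at hw
      simpa using hw
  · intro h
    exact ⟨⟨v, (gcd_val_eq_one_iff v).2 hv⟩, h, rfl⟩

theorem rep_snd_ne_zero (x : Vertex' p) : (rep x.1).2 ≠ 0 := by
  intro h
  apply x.2
  rw [← mk_rep x.1]
  exact mk_mem_principalAxis.2 h

theorem ne_zero_of_snd {v : ZMod p × ZMod p} (hv : v.2 ≠ 0) : v ≠ 0 := by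
  rintro rfl
  exact hv rfl

/-- The vertex `[v]` off the principal axis of a vector `v` with nonzero second coordinate. -/
def mk' (v : ZMod p × ZMod p) (hv : v.2 ≠ 0) : Vertex' p :=
  ⟨mk v (ne_zero_of_snd hv), fun h => hv (mk_mem_principalAxis.1 h)⟩

theorem mk'_rep (x : Vertex' p) : mk' (rep x.1) (rep_snd_ne_zero x) = x :=
  Subtype.ext (mk_rep x.1)

theorem mk'_eq_mk' {v w : ZMod p × ZMod p} {hv : v.2 ≠ 0} {hw : w.2 ≠ 0} :
    mk' v hv = mk' w hw ↔ v = w ∨ v = -w := by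
  rw [Subtype.ext_iff]
  exact mk_eq_mk (hv := ne_zero_of_snd hv) (hw := ne_zero_of_snd hw)

theorem adj'_mk' {v w : ZMod p × ZMod p} {hv : v.2 ≠ 0} {hw : w.2 ≠ 0} :
    (graph' p).Adj (mk' v hv) (mk' w hw) ↔ pairing v w = 1 ∨ pairing v w = -1 := Iff.rfl

theorem adj'_iff {x y : Vertex' p} : (graph' p).Adj x y ↔ (graph p).Adj x.1 y.1 := Iff.rfl

theorem two_ne_zero_of_odd (hp : Odd p) : (2 : ZMod p) ≠ 0 := by
  have h : ringChar (ZMod p) ≠ 2 := by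
    rw [ZMod.ringChar_zmod_n]
    rintro rfl
    exact absurd hp (by decide)
  exact Ring.two_ne_zero h

theorem ne_neg_of_ne_zero (hp : Odd p) {a : ZMod p} (ha : a ≠ 0) : a ≠ -a := by
  intro h
  have : (2 : ZMod p) * a = 0 := by linear_combination h
  exact (mul_ne_zero (two_ne_zero_of_odd hp) ha) this

end Basics

/-! ### Neighbourhoods as affine lines, and regularity -/

section Neighbours

variable {p : ℕ} [Fact p.Prime]

theorem pairing_line {v e : ZMod p × ZMod p} (h : pairing v e = 1) (s : ZMod p) :
    pairing v (s • v + e) = 1 := by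
  rw [pairing_add_right, pairing_smul_right, pairing_self, h]; ring

theorem line_ne_zero {v e : ZMod p × ZMod p} (h : pairing v e = 1) (s : ZMod p) :
    s • v + e ≠ 0 := by
  intro h0
  have := pairing_line h s
  rw [h0, pairing_zero_right] at this
  exact zero_ne_one this

/-- Pairing with `v` is constantly `1` on the line and `-1` on its negative, and these differ for
odd `p`. -/
theorem line_eq_or_neg (hp : Odd p) {v e : ZMod p × ZMod p} (h : pairing v e = 1) {s t : ZMod p}
    (hst : s • v + e = t • v + e ∨ s • v + e = -(t • v + e)) : s = t := by
  rcases hst with hst | hst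
  · have := congrArg (fun x => pairing x e) hst
    simpa [pairing_add_left, pairing_smul_left, h] using this
  · have := congrArg (pairing v) hst
    rw [pairing_neg_right, pairing_line h, pairing_line h] at this
    exact absurd this (ne_neg_of_ne_zero hp one_ne_zero)

/-- By Cramer's rule the `e`-coordinate of a neighbour is its pairing with `v`, which a choice of
sign makes `1`; the `v`-coordinate is free. -/
theorem adj_mk_iff_exists {v e : ZMod p × ZMod p} {hv : v ≠ 0} (h : pairing v e = 1)
    (x : Vertex p) :
    (graph p).Adj (mk v hv) x ↔ ∃ s : ZMod p, mk (s • v + e) (line_ne_zero h s) = x := by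
  constructor
  · intro hx
    rw [← mk_rep x, adj_mk] at hx
    refine ⟨if pairing v (rep x) = 1 then pairing (rep x) e else -pairing (rep x) e, ?_⟩
    conv_rhs => rw [← mk_rep x]
    rw [mk_eq_mk]
    have hc := eq_smul_add_smul h (rep x)
    split_ifs with h1
    · left
      rw [h1, one_smul] at hc
      exact hc.symm
    · right
      rw [hx.resolve_left h1] at hc
      conv_rhs => rw [hc]
      module
  · rintro ⟨s, rfl⟩
    exact adj_mk.2 (Or.inl (pairing_line h s))

/-- The vector on the principal axis whose pairing with `v` is one. -/
def axisVector (v : ZMod p × ZMod p) : ZMod p × ZMod p := (-v.2⁻¹, 0)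

theorem pairing_axisVector {v : ZMod p × ZMod p} (hv : v.2 ≠ 0) : pairing v (axisVector v) = 1 := by
  simp [pairing, axisVector, hv]

theorem line_axisVector_snd (v : ZMod p × ZMod p) (s : ZMod p) :
    (s • v + axisVector v).2 = s * v.2 := by
  simp [axisVector]

theorem line_axisVector_snd_ne_zero {v : ZMod p × ZMod p} (hv : v.2 ≠ 0) {s : ZMod p}
    (hs : s ≠ 0) : (s • v + axisVector v).2 ≠ 0 := by
  rw [line_axisVector_snd]; exact mul_ne_zero hs hv

/-- The neighbours of `[v]` off the principal axis, indexed by the units. -/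
def neighbour (v : ZMod p × ZMod p) (hv : v.2 ≠ 0) (s : (ZMod p)ˣ) : Vertex' p :=
  mk' ((s : ZMod p) • v + axisVector v) (line_axisVector_snd_ne_zero hv s.ne_zero)

theorem neighbour_injective (hp : Odd p) (v : ZMod p × ZMod p) (hv : v.2 ≠ 0) :
    Function.Injective (neighbour v hv) := by
  intro s t hst
  exact Units.ext (line_eq_or_neg hp (pairing_axisVector hv) (mk'_eq_mk'.1 hst))

theorem adj'_mk'_iff_exists {v : ZMod p × ZMod p} {hv : v.2 ≠ 0} (x : Vertex' p) :
    (graph' p).Adj (mk' v hv) x ↔ ∃ s, neighbour v hv s = x := by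
  rw [adj'_iff]
  refine (adj_mk_iff_exists (hv := ne_zero_of_snd hv) (pairing_axisVector hv) x.1).trans ?_
  constructor
  · rintro ⟨s, hs⟩
    have hs0 : s ≠ 0 := by
      rintro rfl
      apply x.2
      rw [← hs, mk_mem_principalAxis, line_axisVector_snd, zero_mul]
    exact ⟨Units.mk0 s hs0, Subtype.ext hs⟩
  · rintro ⟨s, rfl⟩
    exact ⟨s, rfl⟩

theorem isRegular_graph (hp : Odd p) : IsRegular (graph p) p := by
  classical
  intro x
  obtain ⟨e, he⟩ := exists_pairing_eq_one (rep_ne_zero x)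
  have hi : Function.Injective
      (fun s : ZMod p => mk (s • rep x + e) (line_ne_zero he s)) :=
    fun s t hst => line_eq_or_neg hp he (mk_eq_mk.1 hst)
  have : (graph p).neighborFinset x = univ.image
      (fun s : ZMod p => mk (s • rep x + e) (line_ne_zero he s)) := by
    ext y
    rw [SimpleGraph.mem_neighborFinset]
    conv_lhs => rw [← mk_rep x]
    rw [adj_mk_iff_exists he]
    simp
  rw [← SimpleGraph.card_neighborFinset_eq_degree, this, card_image_of_injective _ hi, card_univ,
    ZMod.card]

theorem isRegular_graph' (hp : Odd p) : IsRegular (graph' p) (p - 1) := by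
  classical
  intro x
  have : (graph' p).neighborFinset x = univ.image (neighbour (rep x.1) (rep_snd_ne_zero x)) := by
    ext y
    rw [SimpleGraph.mem_neighborFinset]
    conv_lhs => rw [← mk'_rep x]
    rw [adj'_mk'_iff_exists]
    simp
  rw [← SimpleGraph.card_neighborFinset_eq_degree, this,
    card_image_of_injective _ (neighbour_injective hp _ _), card_univ, ZMod.card_units]

end Neighbours

/-! ### Diameter -/

section Diameter

theorem ediam_eq_three {V : Type*} {G : SimpleGraph V} {a b : V} (hab : a ≠ b)
    (hadj : ¬ G.Adj a b) (hcn : ∀ z, G.Adj a z → ¬ G.Adj z b)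
    (hup : ∀ x y, ∃ w : G.Walk x y, w.length ≤ 3) : G.ediam = 3 := by
  apply le_antisymm
  · apply SimpleGraph.ediam_le_of_edist_le
    intro x y
    obtain ⟨w, hw⟩ := hup x y
    exact w.edist_le.trans (by exact_mod_cast hw)
  · refine le_trans ?_ (SimpleGraph.edist_le_ediam (u := a) (v := b))
    obtain ⟨w, -⟩ := hup a b
    obtain ⟨q, hq⟩ := (SimpleGraph.Walk.reachable w).exists_walk_length_eq_edist
    rw [← hq]
    match q, hq with
    | .nil, _ => exact absurd rfl hab
    | .cons h .nil, _ => exact absurd h hadj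
    | .cons h (.cons h' .nil), _ => exact absurd h' (hcn _ h)
    | .cons _ (.cons _ (.cons _ q)), _ =>
      simp only [SimpleGraph.Walk.length_cons]
      exact_mod_cast (by omega : 3 ≤ q.length + 1 + 1 + 1)

variable {p : ℕ} [Fact p.Prime]

theorem ne_zero_of_pairing {v w : ZMod p × ZMod p} (h : pairing v w ≠ 0) : w ≠ 0 := by
  rintro rfl
  exact h (pairing_zero_right v)

/-- Both `pairing v (v + w)` and `pairing (v + w) w` equal `pairing v w`, so rescaling `v + w` makes
both equal to `1`. -/
theorem exists_common_neighbour {v w : ZMod p × ZMod p} (hv : v ≠ 0) (hw : w ≠ 0)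
    (h : pairing v w ≠ 0) : ∃ z, (graph p).Adj (mk v hv) z ∧ (graph p).Adj z (mk w hw) := by
  have h1 : pairing v ((pairing v w)⁻¹ • (v + w)) = 1 := by
    rw [pairing_smul_right, pairing_add_right, pairing_self, zero_add, inv_mul_cancel₀ h]
  refine ⟨mk ((pairing v w)⁻¹ • (v + w)) (ne_zero_of_pairing (h1 ▸ one_ne_zero)),
    adj_mk.2 (Or.inl h1), adj_mk.2 (Or.inl ?_)⟩
  rw [pairing_smul_left, pairing_add_left, pairing_self, add_zero, inv_mul_cancel₀ h]

theorem exists_common_neighbour' (hp : Odd p) {v w : ZMod p × ZMod p} (hv : v.2 ≠ 0) (hw : w.2 ≠ 0)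
    (h : pairing v w ≠ 0) :
    ∃ z, (graph' p).Adj (mk' v hv) z ∧ (graph' p).Adj z (mk' w hw) := by
  -- In this case `v + w` lies on the principal axis. Replacing `w` by `-w`, which represents the
  -- same vertex, avoids the axis because `p` is odd.
  by_cases hs : v.2 + w.2 = 0
  · have hd : v.2 - w.2 ≠ 0 := by
      intro hd
      apply ne_neg_of_ne_zero hp hv
      linear_combination hs + hd
    refine ⟨mk' ((pairing v w)⁻¹ • (v + -w)) ?_, adj'_mk'.2 (Or.inr ?_), adj'_mk'.2 (Or.inl ?_)⟩
    · rw [Prod.smul_snd, Prod.snd_add, Prod.snd_neg, ← sub_eq_add_neg]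
      exact mul_ne_zero (inv_ne_zero h) hd
    · rw [pairing_smul_right, pairing_add_right, pairing_self, pairing_neg_right, zero_add, mul_neg,
        inv_mul_cancel₀ h]
    · rw [pairing_smul_left, pairing_add_left, pairing_neg_left, pairing_self, neg_zero, add_zero,
        inv_mul_cancel₀ h]
  · refine ⟨mk' ((pairing v w)⁻¹ • (v + w)) (mul_ne_zero (inv_ne_zero h) hs),
      adj'_mk'.2 (Or.inl ?_), adj'_mk'.2 (Or.inl ?_)⟩
    · rw [pairing_smul_right, pairing_add_right, pairing_self, zero_add, inv_mul_cancel₀ h]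
    · rw [pairing_smul_left, pairing_add_left, pairing_self, add_zero, inv_mul_cancel₀ h]

theorem exists_walk (x y : Vertex p) : ∃ w : (graph p).Walk x y, w.length ≤ 3 := by
  rw [← mk_rep x, ← mk_rep y]
  by_cases h : pairing (rep x) (rep y) = 0
  · obtain ⟨e, he⟩ := exists_pairing_eq_one (rep_ne_zero x)
    obtain ⟨c, hc⟩ := exists_smul_of_pairing_eq_zero (rep_ne_zero x) h
    have hc0 : c ≠ 0 := by
      rintro rfl
      exact rep_ne_zero y (by rw [hc, zero_smul])
    have he0 : e ≠ 0 := ne_zero_of_pairing (he ▸ one_ne_zero)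
    have hey : pairing e (rep y) ≠ 0 := by
      rw [hc, pairing_smul_right, pairing_swap, he]
      simpa using hc0
    obtain ⟨z, hz, hz'⟩ := exists_common_neighbour he0 (rep_ne_zero y) hey
    exact ⟨.cons (adj_mk.2 (Or.inl he)) (.cons hz (.cons hz' .nil)), le_refl _⟩
  · obtain ⟨z, hz, hz'⟩ := exists_common_neighbour (rep_ne_zero x) (rep_ne_zero y) h
    exact ⟨.cons hz (.cons hz' .nil), by simp⟩

theorem exists_walk' (hp : Odd p) (x y : Vertex' p) :
    ∃ w : (graph' p).Walk x y, w.length ≤ 3 := by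
  rw [← mk'_rep x, ← mk'_rep y]
  have hx := rep_snd_ne_zero x
  by_cases h : pairing (rep x.1) (rep y.1) = 0
  · obtain ⟨c, hc⟩ := exists_smul_of_pairing_eq_zero (rep_ne_zero x.1) h
    have hc0 : c ≠ 0 := by
      rintro rfl
      exact rep_ne_zero y.1 (by rw [hc, zero_smul])
    -- The axis vector itself is not available in `Π'_p`; the point `s = 1` of the line is off the
    -- axis.
    have he := pairing_line (pairing_axisVector hx) 1
    have hey : pairing ((1 : ZMod p) • rep x.1 + axisVector (rep x.1)) (rep y.1) ≠ 0 := by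
      rw [hc, pairing_smul_right, pairing_swap, he]
      simpa using hc0
    obtain ⟨z, hz, hz'⟩ := exists_common_neighbour' hp
      (line_axisVector_snd_ne_zero hx one_ne_zero) (rep_snd_ne_zero y) hey
    exact ⟨.cons (adj'_mk'.2 (Or.inl he)) (.cons hz (.cons hz' .nil)), le_refl _⟩
  · obtain ⟨z, hz, hz'⟩ := exists_common_neighbour' hp hx (rep_snd_ne_zero y) h
    exact ⟨.cons hz (.cons hz' .nil), by simp⟩

theorem three_ne_zero_of_ne (h3 : p ≠ 3) : (3 : ZMod p) ≠ 0 := by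
  intro h
  have h' : ((3 : ℕ) : ZMod p) = 0 := by exact_mod_cast h
  rw [ZMod.natCast_eq_zero_iff] at h'
  exact h3 ((Nat.prime_dvd_prime_iff_eq Fact.out Nat.prime_three).1 h')

theorem one_ne_two_and (h3 : p ≠ 3) : (1 : ZMod p) ≠ 2 ∧ (1 : ZMod p) ≠ -2 := by
  constructor
  · intro h
    exact one_ne_zero (by linear_combination -h : (1 : ZMod p) = 0)
  · intro h
    exact three_ne_zero_of_ne h3 (by linear_combination h)

/-- A common neighbour of `[0, 1]` and `[0, 2]` would have a first coordinate `a` with `a = ±1` and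
`2 a = ±1`, forcing `1 = ±2`, which happens only for `p = 3`. -/
theorem ediam_graph' (hp : Odd p) (h3 : p ≠ 3) : (graph' p).ediam = 3 := by
  have h2 := two_ne_zero_of_odd hp
  obtain ⟨h12, h12'⟩ := one_ne_two_and h3
  refine ediam_eq_three (a := mk' (0, 1) one_ne_zero) (b := mk' (0, 2) h2) ?_ ?_ ?_ (exists_walk' hp)
  · rw [Ne, mk'_eq_mk']
    simp [h12, h12']
  · rw [adj'_mk']
    simp [pairing]
  · intro z
    rw [← mk'_rep z, adj'_mk', adj'_mk']
    simp only [pairing, zero_mul, zero_sub, one_mul, mul_zero, sub_zero]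
    rintro (h | h) (h' | h')
    · exact h12' (by linear_combination (-2) * h - h')
    · exact h12 (by linear_combination 2 * h + h')
    · exact h12 (by linear_combination (-2) * h - h')
    · exact h12' (by linear_combination 2 * h + h')

theorem ediam_graph (hp : Odd p) (h3 : p ≠ 3) : (graph p).ediam = 3 := by
  have h2 := two_ne_zero_of_odd hp
  obtain ⟨h12, h12'⟩ := one_ne_two_and h3
  refine ediam_eq_three (a := mk (0, 1) (ne_zero_of_snd one_ne_zero))
    (b := mk (0, 2) (ne_zero_of_snd h2)) ?_ ?_ ?_ exists_walk
  · rw [Ne, mk_eq_mk]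
    simp [h12, h12']
  · rw [adj_mk]
    simp [pairing]
  · intro z
    rw [← mk_rep z, adj_mk, adj_mk]
    simp only [pairing, zero_mul, zero_sub, one_mul, mul_zero, sub_zero]
    rintro (h | h) (h' | h')
    · exact h12' (by linear_combination (-2) * h - h')
    · exact h12 (by linear_combination 2 * h + h')
    · exact h12 (by linear_combination (-2) * h - h')
    · exact h12' (by linear_combination 2 * h + h')

theorem zmod_three_cases (a : ZMod 3) : a = 0 ∨ a = 1 ∨ a = -1 := by
  revert a; decide

theorem graph_three [Fact (Nat.Prime 3)] : graph 3 = ⊤ := by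
  ext x y
  rw [SimpleGraph.top_adj]
  refine ⟨SimpleGraph.Adj.ne, fun hxy => adj_iff_rep.2 ?_⟩
  rcases zmod_three_cases (pairing (rep x) (rep y)) with h | h
  · exfalso
    obtain ⟨c, hc⟩ := exists_smul_of_pairing_eq_zero (rep_ne_zero x) h
    refine hxy (eq_iff_rep.2 ?_)
    rcases zmod_three_cases c with rfl | rfl | rfl
    · exact absurd (by simpa using hc) (rep_ne_zero y)
    · left; simpa using hc.symm
    · right; rw [hc]; simp
  · exact h

theorem nontrivial_vertex' : Nontrivial (Vertex' p) := by
  refine ⟨mk' (0, 1) one_ne_zero, mk' (1, 1) one_ne_zero, ?_⟩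
  rw [Ne, mk'_eq_mk']
  simp [Prod.ext_iff]

theorem nontrivial_vertex : Nontrivial (Vertex p) :=
  have := nontrivial_vertex' (p := p)
  (Subtype.val_injective (p := (· ∈ (principalAxis p)ᶜ))).nontrivial

theorem ediam_graph_three [Fact (Nat.Prime 3)] : (graph 3).ediam = 1 := by
  have := nontrivial_vertex (p := 3)
  rw [graph_three, SimpleGraph.ediam_top]

theorem ediam_graph'_three [Fact (Nat.Prime 3)] : (graph' 3).ediam = 1 := by
  have := nontrivial_vertex' (p := 3)
  rw [SimpleGraph.ediam_eq_one]
  ext x y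
  rw [adj'_iff, graph_three, SimpleGraph.top_adj, SimpleGraph.top_adj, Ne, Ne, Subtype.ext_iff]

end Diameter

/-! ### Vertex connectivity -/

section Connectivity

/-- Otherwise the `d` neighbours of some `x` could be removed, leaving `x` isolated from a further
vertex. -/
theorem IsVertexConnected.le_of_isRegular {V : Type*} [Fintype V] {G : SimpleGraph V} {d k : ℕ}
    (hk : IsVertexConnected G k) (hG : IsRegular G d) : k ≤ d := by
  classical
  by_contra! hdk
  obtain ⟨x⟩ : Nonempty V := Fintype.card_pos_iff.1 (by have := hk.1; omega)
  have hd : (G.neighborFinset x).card = d := by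
    rw [SimpleGraph.card_neighborFinset_eq_degree]
    convert hG x
  obtain ⟨y, hy⟩ : ∃ y, y ∉ insert x (G.neighborFinset x) := by
    by_contra! h
    have h1 := card_le_card (fun y _ => h y : (univ : Finset V) ⊆ _)
    have h2 := card_insert_le x (G.neighborFinset x)
    have := hk.1
    rw [card_univ] at h1
    omega
  rw [mem_insert, not_or] at hy
  have hc := hk.2 (G.neighborFinset x) (by omega)
  have hx : x ∉ G.neighborFinset x := by simp
  obtain ⟨w⟩ := hc.preconnected ⟨x, hx⟩ ⟨y, hy.2⟩
  cases w with
  | nil => exact hy.1 rfl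
  | cons h w =>
    rename_i z
    exact z.2 (by rw [SimpleGraph.mem_neighborFinset]; exact h)

theorem vertexConnectivity_eq {V : Type*} [Fintype V] {G : SimpleGraph V} {d : ℕ}
    (hd : IsVertexConnected G d) (hG : IsRegular G d) : vertexConnectivity G = d :=
  IsGreatest.csSup_eq ⟨hd, fun _ hk => hk.le_of_isRegular hG⟩

/-- If `S` met every pair `{f i, g i}`, picking a member in `S` for each `i` would inject `I` into
`S`. -/
theorem exists_pair_not_mem {V ι : Type*} {S : Finset V} {I : Finset ι}
    (hc : S.card < I.card) {f g : ι → V} (hf : Set.InjOn f I) (hg : Set.InjOn g I)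
    (hfg : ∀ i ∈ I, ∀ j ∈ I, f i ≠ g j) : ∃ i ∈ I, f i ∉ S ∧ g i ∉ S := by
  classical
  by_contra! h
  refine absurd (card_le_card_of_injOn (s := I) (t := S)
    (fun i => if f i ∈ S then f i else g i) ?_ ?_) (not_le.2 hc)
  · intro i hi
    by_cases h' : f i ∈ S
    · simp [h']
    · simp [h', h i hi h']
  · intro i hi j hj hij
    dsimp only at hij
    split_ifs at hij
    · exact hf hi hj hij
    · exact absurd hij (hfg i hi j hj)
    · exact absurd hij.symm (hfg j hj i hi)
    · exact hg hi hj hij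

/-- The vertices `x` and `y` are joined by a walk in `G` that avoids `S`. -/
def ReachableOff {V : Type*} (G : SimpleGraph V) (S : Finset V) (x y : V) : Prop :=
  ∃ (hx : x ∉ S) (hy : y ∉ S), (G.induce {v | v ∉ S}).Reachable ⟨x, hx⟩ ⟨y, hy⟩

section ReachableOff

variable {V : Type*} {G : SimpleGraph V} {S : Finset V} {x y z : V}

theorem ReachableOff.of_adj (h : G.Adj x y) (hx : x ∉ S) (hy : y ∉ S) : ReachableOff G S x y :=
  ⟨hx, hy, SimpleGraph.Adj.reachable (G := G.induce {v | v ∉ S}) (u := ⟨x, hx⟩) (v := ⟨y, hy⟩) h⟩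

theorem ReachableOff.refl (hx : x ∉ S) : ReachableOff G S x x := ⟨hx, hx, .refl _⟩

theorem ReachableOff.trans (h : ReachableOff G S x y) (h' : ReachableOff G S y z) :
    ReachableOff G S x z := by
  obtain ⟨hx, _, h⟩ := h
  obtain ⟨_, hz, h'⟩ := h'
  exact ⟨hx, hz, h.trans h'⟩

theorem connected_of_reachableOff (b : V) (h : ∀ x ∉ S, ReachableOff G S x b) (hb : b ∉ S) :
    (G.induce {v | v ∉ S}).Connected := by
  refine (SimpleGraph.connected_iff_exists_forall_reachable _).2 ⟨⟨b, hb⟩, fun x => ?_⟩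
  obtain ⟨_, _, h⟩ := h x.1 x.2
  exact h.symm

end ReachableOff

variable {p : ℕ} [Fact p.Prime]

theorem pairing_line_inv {v e : ZMod p × ZMod p} (h : pairing v e = 1) (s c : ZMod p) :
    pairing v (s • v + c⁻¹ • e) = c⁻¹ := by
  rw [pairing_add_right, pairing_smul_right, pairing_smul_right, pairing_self, h]; ring

theorem line_inv_ne_zero {v e : ZMod p × ZMod p} (h : pairing v e = 1) (s : ZMod p) {c : ZMod p}
    (hc : c ≠ 0) : s • v + c⁻¹ • e ≠ 0 :=
  ne_zero_of_pairing (v := v) (by rw [pairing_line_inv h]; exact inv_ne_zero hc)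

/-- This is the middle edge of a path from `v` to `c • v`: it exists as soon as `s - t = ±1`. -/
theorem pairing_line_line_inv {v e : ZMod p × ZMod p} (h : pairing v e = 1) (s t : ZMod p)
    {c : ZMod p} (hc : c ≠ 0) :
    pairing ((s * c) • v + e) (t • v + c⁻¹ • e) = s - t := by
  have h' : pairing e v = -1 := by rw [pairing_swap, h]
  simp only [pairing_add_right, pairing_smul_right, pairing_add_left, pairing_smul_left,
    pairing_self, h, h']
  field_simp
  ring

theorem pairing_line_inv_smul {v e : ZMod p × ZMod p} (h : pairing v e = 1) (t : ZMod p)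
    {c : ZMod p} (hc : c ≠ 0) : pairing (t • v + c⁻¹ • e) (c • v) = -1 := by
  rw [pairing_smul_right, pairing_swap, pairing_line_inv h, mul_neg, mul_inv_cancel₀ hc]

/-- The two vectors are the inner vertices of the `j`-th path from `v` to `c • v`. Paths with
different `j` are disjoint inside: pairing with `v` is `1` on the first family and `c⁻¹` on the
second, which differ up to sign since `c ≠ ±1`. -/
theorem exists_avoiding_pair (hp : Odd p) {v e : ZMod p × ZMod p} (he : pairing v e = 1)
    {c : ZMod p} (hc : c ≠ 0) (hc1 : c ≠ 1) (hc2 : c ≠ -1) {I : Finset (ZMod p)}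
    {σ : ZMod p → ZMod p} (hσ : Set.InjOn σ I) {S : Finset (Vertex p)} (hS : S.card < I.card) :
    ∃ j ∈ I, mk ((j * c) • v + e) (line_ne_zero he _) ∉ S ∧
      mk (σ j • v + c⁻¹ • e) (line_inv_ne_zero he _ hc) ∉ S := by
  refine exists_pair_not_mem hS ?_ ?_ ?_
  · intro i _ j _ hij
    exact mul_right_cancel₀ hc (line_eq_or_neg hp he (mk_eq_mk.1 hij))
  · intro i hi j hj hij
    apply hσ hi hj
    rcases mk_eq_mk.1 hij with hij | hij
    · have := congrArg (fun x => pairing x e) hij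
      simpa [pairing_add_left, pairing_smul_left, he, pairing_self] using this
    · have := congrArg (pairing v) hij
      rw [pairing_neg_right, pairing_line_inv he, pairing_line_inv he] at this
      exact absurd this (ne_neg_of_ne_zero hp (inv_ne_zero hc))
  · intro i _ j _ hij
    rcases mk_eq_mk.1 hij with hij | hij
    · have := congrArg (pairing v) hij
      rw [pairing_line he, pairing_line_inv he] at this
      exact hc1 (by rw [← inv_inv c, ← this, inv_one])
    · have := congrArg (pairing v) hij
      rw [pairing_neg_right, pairing_line he, pairing_line_inv he] at this
      exact hc2 (by rw [← inv_inv c, ← neg_eq_iff_eq_neg.2 this]; simp)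

theorem reachableOff_of_pairing_eq_zero (hp : Odd p) {S : Finset (Vertex p)} (hS : S.card < p)
    {v w : ZMod p × ZMod p} {hv : v ≠ 0} {hw : w ≠ 0} (h : pairing v w = 0)
    (hvS : mk v hv ∉ S) (hwS : mk w hw ∉ S) : ReachableOff (graph p) S (mk v hv) (mk w hw) := by
  obtain ⟨c, rfl⟩ := exists_smul_of_pairing_eq_zero hv h
  have hc : c ≠ 0 := by
    rintro rfl
    exact hw (zero_smul _ _)
  by_cases hc1 : c = 1 ∨ c = -1
  · have : mk v hv = mk (c • v) hw := by
      rw [mk_eq_mk]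
      rcases hc1 with rfl | rfl
      · left; simp
      · right; simp
    rw [← this]
    exact .refl hvS
  rw [not_or] at hc1
  obtain ⟨e, he⟩ := exists_pairing_eq_one hv
  obtain ⟨j, -, h1, h2⟩ := exists_avoiding_pair hp he hc hc1.1 hc1.2 (I := univ)
    (σ := fun j => j + 1) (fun i _ j _ hij => add_right_cancel hij)
    (S := S) (by rwa [card_univ, ZMod.card])
  refine ((ReachableOff.of_adj (adj_mk.2 (.inl (pairing_line he _))) hvS h1).trans
    (.of_adj (adj_mk.2 (.inr ?_)) h1 h2)).trans
      (.of_adj (adj_mk.2 (.inr (pairing_line_inv_smul he _ hc))) h2 hwS)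
  rw [pairing_line_line_inv he _ _ hc]; ring

/-- The fixed-point free involution of the nonzero residues that exchanges `2 i + 1` and
`2 i + 2`. -/
def shift (j : ZMod p) : ZMod p := if Even j.val then j - 1 else j + 1

theorem val_shift (hp : Odd p) {j : ZMod p} (hj : j ≠ 0) :
    (shift j).val = if Even j.val then j.val - 1 else j.val + 1 := by
  have h0 : 0 < j.val := ZMod.val_pos.2 hj
  have hlt := j.val_lt
  unfold shift
  split_ifs with h
  · rw [ZMod.val_sub (by rw [ZMod.val_one]; omega), ZMod.val_one]
  · rw [ZMod.val_add, ZMod.val_one, Nat.mod_eq_of_lt]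
    -- An odd residue is not the even number `p - 1`, so adding one does not wrap around.
    rw [Nat.not_even_iff_odd] at h
    obtain ⟨a, ha⟩ := h
    obtain ⟨b, hb⟩ := hp
    omega

theorem shift_ne_zero (hp : Odd p) {j : ZMod p} (hj : j ≠ 0) : shift j ≠ 0 := by
  rw [← ZMod.val_pos, val_shift hp hj]
  have h0 : 0 < j.val := ZMod.val_pos.2 hj
  split_ifs with h
  · obtain ⟨a, ha⟩ := h
    omega
  · omega

theorem shift_injOn (hp : Odd p) : Set.InjOn (shift (p := p)) {j | j ≠ 0} := by
  intro i hi j hj hij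
  have hij' := congrArg ZMod.val hij
  rw [val_shift hp hi, val_shift hp hj] at hij'
  have hi0 : 0 < i.val := ZMod.val_pos.2 hi
  have hj0 : 0 < j.val := ZMod.val_pos.2 hj
  apply ZMod.val_injective
  simp only [Nat.even_iff] at hij'
  split_ifs at hij' <;> omega

theorem reachableOff'_of_pairing_eq_zero (hp : Odd p) {S : Finset (Vertex' p)}
    (hS : S.card < p - 1) {v w : ZMod p × ZMod p} {hv : v.2 ≠ 0} {hw : w.2 ≠ 0}
    (h : pairing v w = 0) (hvS : mk' v hv ∉ S) (hwS : mk' w hw ∉ S) :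
    ReachableOff (graph' p) S (mk' v hv) (mk' w hw) := by
  have hv0 := ne_zero_of_snd hv
  obtain ⟨c, rfl⟩ := exists_smul_of_pairing_eq_zero hv0 h
  have hc : c ≠ 0 := by
    rintro rfl
    exact hw (by simp)
  by_cases hc1 : c = 1 ∨ c = -1
  · have : mk' v hv = mk' (c • v) hw := by
      rw [mk'_eq_mk']
      rcases hc1 with rfl | rfl
      · left; simp
      · right; simp
    rw [← this]
    exact .refl hvS
  rw [not_or] at hc1
  have he := pairing_axisVector hv
  -- Both inner vertices must avoid the axis, so `j` and its image must be nonzero. The translation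
  -- `j + 1` fails at `j = -1`; `shift` moves by `±1` within the nonzero residues.
  obtain ⟨j, hj, h1, h2⟩ := exists_avoiding_pair hp he hc hc1.1 hc1.2 (I := univ.erase 0)
    (σ := shift) ((shift_injOn hp).mono (by intro j; simp))
    (S := S.map (Function.Embedding.subtype _))
    (by rwa [card_map, card_erase_of_mem (mem_univ _), card_univ, ZMod.card])
  have hj0 : j ≠ 0 := (mem_erase.1 hj).1
  have h1' : mk' _ (line_axisVector_snd_ne_zero hv (mul_ne_zero hj0 hc)) ∉ S :=
    fun h => h1 (mem_map_of_mem (Function.Embedding.subtype _) h)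
  have hn : (shift j • v + c⁻¹ • axisVector v).2 ≠ 0 := by
    simpa [axisVector, hv] using shift_ne_zero hp hj0
  have h2' : mk' _ hn ∉ S :=
    fun h => h2 (mem_map_of_mem (Function.Embedding.subtype _) h)
  refine ((ReachableOff.of_adj (adj'_mk'.2 (.inl (pairing_line he _))) hvS h1').trans
    (.of_adj (adj'_mk'.2 ?_) h1' h2')).trans
      (.of_adj (adj'_mk'.2 (.inr (pairing_line_inv_smul he _ hc))) h2' hwS)
  rw [pairing_line_line_inv he _ _ hc]
  unfold shift
  split_ifs
  · left; ring
  · right; ring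

theorem isVertexConnected_graph (hp : Odd p) : IsVertexConnected (graph p) p := by
  classical
  have hreg := isRegular_graph hp
  constructor
  · exact (hreg (mk (0, 1) (ne_zero_of_snd one_ne_zero))).symm.trans_lt
      (SimpleGraph.degree_lt_card_verts _)
  intro S hS
  -- Fewer than `p` slopes are hit by `S`, so the line of some slope `k` is untouched. Axis vertices
  -- get the default slope `0` from `0⁻¹ = 0`, which at worst excludes one slope needlessly.
  obtain ⟨k, hk⟩ : ∃ k, k ∉ S.image (fun x => (rep x).1 * (rep x).2⁻¹) := by
    by_contra! h
    have h1 := card_le_card (fun y _ => h y : (univ : Finset (ZMod p)) ⊆ _)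
    rw [card_univ, ZMod.card] at h1
    have := h1.trans card_image_le
    omega
  have hl : ∀ (t : ZMod p) (ht : t ≠ 0), mk (t • (k, 1)) (ne_zero_of_snd (by simpa)) ∉ S := by
    intro t ht hmem
    apply hk
    refine mem_image.2 ⟨_, hmem, ?_⟩
    rcases rep_mk (t • ((k, 1) : ZMod p × ZMod p)) (ne_zero_of_snd (by simpa)) with h | h
    · rw [h]; simp; field_simp
    · rw [h]; simp; field_simp
  have hb : mk ((k, 1) : ZMod p × ZMod p) (ne_zero_of_snd one_ne_zero) ∉ S := by
    have := hl 1 one_ne_zero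
    simpa only [one_smul] using this
  refine connected_of_reachableOff _ (fun x hx => ?_) hb
  rw [← mk_rep x] at hx ⊢
  by_cases h : pairing (rep x) (k, 1) = 0
  · exact reachableOff_of_pairing_eq_zero hp hS h hx hb
  · refine (ReachableOff.of_adj (adj_mk.2 (.inl ?_)) hx (hl _ (inv_ne_zero h))).trans
      (reachableOff_of_pairing_eq_zero hp hS ?_ (hl _ (inv_ne_zero h)) hb)
    · rw [pairing_smul_right, inv_mul_cancel₀ h]
    · rw [pairing_smul_left, pairing_self, mul_zero]

theorem isVertexConnected_graph' (hp : Odd p) : IsVertexConnected (graph' p) (p - 1) := by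
  classical
  have hreg := isRegular_graph' hp
  constructor
  · exact (hreg (mk' (0, 1) one_ne_zero)).symm.trans_lt (SimpleGraph.degree_lt_card_verts _)
  intro S hS
  obtain ⟨k, hk⟩ : ∃ k, k ∉ S.image (fun x => (rep x.1).1 * (rep x.1).2⁻¹) := by
    by_contra! h
    have h1 := card_le_card (fun y _ => h y : (univ : Finset (ZMod p)) ⊆ _)
    rw [card_univ, ZMod.card] at h1
    have := h1.trans card_image_le
    omega
  have hl : ∀ (t : ZMod p) (ht : t ≠ 0), mk' (t • (k, 1)) (by simpa) ∉ S := by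
    intro t ht hmem
    apply hk
    refine mem_image.2 ⟨_, hmem, ?_⟩
    rcases rep_mk (t • ((k, 1) : ZMod p × ZMod p)) (ne_zero_of_snd (by simpa)) with h | h
    · unfold mk'; rw [h]; simp; field_simp
    · unfold mk'; rw [h]; simp; field_simp
  have hb : mk' ((k, 1) : ZMod p × ZMod p) one_ne_zero ∉ S := by
    have := hl 1 one_ne_zero
    simpa only [one_smul] using this
  refine connected_of_reachableOff _ (fun x hx => ?_) hb
  rw [← mk'_rep x] at hx ⊢
  by_cases h : pairing (rep x.1) (k, 1) = 0
  · exact reachableOff'_of_pairing_eq_zero hp hS h hx hb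
  · refine (ReachableOff.of_adj (adj'_mk'.2 (.inl ?_)) hx (hl _ (inv_ne_zero h))).trans
      (reachableOff'_of_pairing_eq_zero hp hS ?_ (hl _ (inv_ne_zero h)) hb)
    · rw [pairing_smul_right, inv_mul_cancel₀ h]
    · rw [pairing_smul_left, pairing_self, mul_zero]

end Connectivity

/-! ### Multiplicities from a resolution of the identity -/

section SpectralResolution

variable {V ι : Type*} [Fintype V] {A : Matrix V V ℝ}
  {E : ι → Matrix V V ℝ} {μ : ι → ℝ}

theorem resolution_mulVec_eq_zero (hEA : ∀ i, E i * A = μ i • E i) {f : V → ℝ} {ν : ℝ}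
    (hf : A.mulVec f = ν • f) {j : ι} (hj : μ j ≠ ν) : (E j).mulVec f = 0 := by
  have h := congrArg (E j).mulVec hf
  rw [Matrix.mulVec_mulVec, hEA, Matrix.smul_mulVec, Matrix.mulVec_smul] at h
  have h' : (μ j - ν) • (E j).mulVec f = 0 := by rw [sub_smul, h, sub_self]
  exact (smul_eq_zero.1 h').resolve_left (sub_ne_zero.2 hj)

variable [DecidableEq V] [Fintype ι]

theorem mulVec_eq_sum_resolution (hsum : ∑ i, E i = 1) (f : V → ℝ) :
    f = ∑ i, (E i).mulVec f := by
  rw [← Matrix.sum_mulVec, hsum, Matrix.one_mulVec]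

theorem exists_eq_of_hasEigenvalue (hsum : ∑ i, E i = 1) (hEA : ∀ i, E i * A = μ i • E i)
    {ν : ℝ} (hν : Module.End.HasEigenvalue A.mulVecLin ν) : ∃ i, ν = μ i := by
  by_contra! h
  obtain ⟨f, hf⟩ := hν.exists_hasEigenvector
  have hf' : A.mulVec f = ν • f := hf.apply_eq_smul
  apply hf.2
  rw [mulVec_eq_sum_resolution hsum f]
  exact sum_eq_zero fun i _ => resolution_mulVec_eq_zero hEA hf' (h i).symm

/-- `E i` maps into the eigenspace of `μ i`, and fixes it because the other `E j` kill it and the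
sum is `1`. It is therefore a projection, with trace equal to its rank. Idempotence need not be
assumed, and `E i = 0` is allowed, as occurs for `p = 3`. -/
theorem finrank_eigenspace_eq_trace (hsum : ∑ i, E i = 1) (hEA : ∀ i, E i * A = μ i • E i)
    (hAE : ∀ i, A * E i = μ i • E i) (hμ : Function.Injective μ) (i : ι) :
    (Module.finrank ℝ (Module.End.eigenspace A.mulVecLin (μ i)) : ℝ) = (E i).trace := by
  have hproj : LinearMap.IsProj (Module.End.eigenspace A.mulVecLin (μ i))
      (Matrix.toLin' (E i)) := by
    constructor
    · intro f
      rw [Module.End.mem_eigenspace_iff, Matrix.mulVecLin_apply, Matrix.toLin'_apply,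
        Matrix.mulVec_mulVec, hAE, Matrix.smul_mulVec]
    · intro f hf
      rw [Module.End.mem_eigenspace_iff, Matrix.mulVecLin_apply] at hf
      rw [Matrix.toLin'_apply]
      conv_rhs => rw [mulVec_eq_sum_resolution hsum f]
      refine (sum_eq_single (f := fun j => (E j).mulVec f) i (fun j _ hj => ?_)
        (fun h => absurd (mem_univ i) h)).symm
      exact resolution_mulVec_eq_zero hEA hf (fun h => hj (hμ h))
  rw [← hproj.trace, Matrix.trace_toLin'_eq]

end SpectralResolution

/-! ### Counting neighbours by line and height -/

section Counting

variable {p : ℕ} [Fact p.Prime]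

/-- `x` and `y` lie on the same line through the origin. -/
def Parallel (x y : Vertex' p) : Prop := pairing (rep x.1) (rep y.1) = 0

/-- `x` and `y` have the same second coordinate up to sign. -/
def SameHeight (x y : Vertex' p) : Prop :=
  (rep x.1).2 = (rep y.1).2 ∨ (rep x.1).2 = -(rep y.1).2

theorem parallel_symm {x y : Vertex' p} (h : Parallel x y) : Parallel y x := by
  unfold Parallel at *
  rw [pairing_swap, h, neg_zero]

theorem sameHeight_symm {x y : Vertex' p} (h : SameHeight x y) : SameHeight y x := by
  unfold SameHeight at *
  rcases h with h | h
  · exact .inl h.symm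
  · exact .inr (by rw [h, neg_neg])

theorem rep_neighbour (v : ZMod p × ZMod p) (hv : v.2 ≠ 0) (s : (ZMod p)ˣ) :
    rep (neighbour v hv s).1 = (s : ZMod p) • v + axisVector v ∨
      rep (neighbour v hv s).1 = -((s : ZMod p) • v + axisVector v) :=
  rep_mk _ (line_ne_zero (pairing_axisVector hv) _)

theorem pairing_neighbour (v w : ZMod p × ZMod p) (s : ZMod p) :
    pairing (s • v + axisVector v) w = s * pairing v w - w.2 / v.2 := by
  rw [pairing_add_left, pairing_smul_left]
  simp only [pairing, axisVector]
  ring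

theorem parallel_neighbour {x y : Vertex' p} (s : (ZMod p)ˣ) :
    Parallel (neighbour (rep x.1) (rep_snd_ne_zero x) s) y ↔
      (s : ZMod p) * pairing (rep x.1) (rep y.1) = (rep y.1).2 / (rep x.1).2 := by
  unfold Parallel
  rcases rep_neighbour (rep x.1) (rep_snd_ne_zero x) s with h | h
  · rw [h, pairing_neighbour, sub_eq_zero]
  · rw [h, pairing_neg_left, pairing_neighbour, neg_eq_zero, sub_eq_zero]

theorem sameHeight_neighbour {x y : Vertex' p} (s : (ZMod p)ˣ) :
    SameHeight (neighbour (rep x.1) (rep_snd_ne_zero x) s) y ↔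
      (s : ZMod p) = (rep y.1).2 / (rep x.1).2 ∨ (s : ZMod p) = -((rep y.1).2 / (rep x.1).2) := by
  have hx := rep_snd_ne_zero x
  unfold SameHeight
  rw [eq_div_iff hx, ← neg_div, eq_div_iff hx]
  rcases rep_neighbour (rep x.1) (rep_snd_ne_zero x) s with h | h
  · rw [h, line_axisVector_snd]
  · rw [h, Prod.snd_neg, line_axisVector_snd, neg_inj, neg_eq_iff_eq_neg, or_comm]

theorem adj'_neighbour {x y : Vertex' p} (s : (ZMod p)ˣ) :
    (graph' p).Adj (neighbour (rep x.1) (rep_snd_ne_zero x) s) y ↔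
      (s : ZMod p) * pairing (rep x.1) (rep y.1) = (rep y.1).2 / (rep x.1).2 + 1 ∨
      (s : ZMod p) * pairing (rep x.1) (rep y.1) = (rep y.1).2 / (rep x.1).2 - 1 := by
  have h := adj'_mk' (v := (s : ZMod p) • rep x.1 + axisVector (rep x.1)) (w := rep y.1)
    (hv := line_axisVector_snd_ne_zero (rep_snd_ne_zero x) s.ne_zero) (hw := rep_snd_ne_zero y)
  rw [mk'_rep y] at h
  unfold neighbour
  rw [h, pairing_neighbour, sub_eq_iff_eq_add', sub_eq_iff_eq_add', ← sub_eq_add_neg]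

open Classical in
/-- The matrix with entries one where `r` holds and zero elsewhere. -/
noncomputable def relMatrix {V : Type*} (r : V → V → Prop) : Matrix V V ℝ :=
  Matrix.of fun x y => if r x y then 1 else 0

open Classical in
theorem adjMatrix_mul_relMatrix (hp : Odd p) (r : Vertex' p → Vertex' p → Prop) (x y : Vertex' p) :
    (((graph' p).adjMatrix ℝ) * relMatrix r) x y =
      (#{s : (ZMod p)ˣ | r (neighbour (rep x.1) (rep_snd_ne_zero x) s) y} : ℝ) := by
  have : (graph' p).neighborFinset x = univ.image (neighbour (rep x.1) (rep_snd_ne_zero x)) := by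
    ext y
    rw [SimpleGraph.mem_neighborFinset]
    conv_lhs => rw [← mk'_rep x]
    rw [adj'_mk'_iff_exists]
    simp
  rw [SimpleGraph.adjMatrix_mul_apply, this, sum_image ((neighbour_injective hp _ _).injOn)]
  simp [relMatrix]

open Classical in
theorem card_units_filter_eq (q : ZMod p) :
    #{s : (ZMod p)ˣ | (s : ZMod p) = q} = if q = 0 then 0 else 1 := by
  split_ifs with h
  · rw [card_eq_zero, filter_eq_empty_iff]
    intro s _ hs
    exact s.ne_zero (hs.trans h)
  · rw [card_eq_one]
    refine ⟨Units.mk0 q h, ?_⟩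
    ext s
    simp [Units.ext_iff]

open Classical in
theorem card_units_filter_or {q r : ZMod p} (h : q ≠ r) :
    #{s : (ZMod p)ˣ | (s : ZMod p) = q ∨ (s : ZMod p) = r} =
      (if q = 0 then 0 else 1) + (if r = 0 then 0 else 1) := by
  rw [filter_or, card_union_of_disjoint, card_units_filter_eq, card_units_filter_eq]
  rw [disjoint_filter]
  intro s _ h1 h2
  exact h (h1.symm.trans h2)

theorem parallel_iff_exists {x y : Vertex' p} :
    Parallel x y ↔ ∃ c : ZMod p, c ≠ 0 ∧ rep y.1 = c • rep x.1 := by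
  constructor
  · intro h
    obtain ⟨c, hc⟩ := exists_smul_of_pairing_eq_zero (rep_ne_zero x.1) h
    refine ⟨c, ?_, hc⟩
    rintro rfl
    exact rep_ne_zero y.1 (by rw [hc, zero_smul])
  · rintro ⟨c, -, hc⟩
    unfold Parallel
    rw [hc, pairing_smul_right, pairing_self, mul_zero]

theorem eq_iff_parallel_and_sameHeight {x y : Vertex' p} :
    x = y ↔ Parallel x y ∧ SameHeight x y := by
  constructor
  · rintro rfl
    exact ⟨pairing_self _, .inl rfl⟩
  · rintro ⟨h, h'⟩
    obtain ⟨c, hc, h⟩ := parallel_iff_exists.1 h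
    have hx := rep_snd_ne_zero x
    rw [Subtype.ext_iff, eq_iff_rep]
    unfold SameHeight at h'
    rw [h] at h' ⊢
    rw [Prod.smul_snd, smul_eq_mul] at h'
    rcases h' with h' | h'
    · have : c = 1 := mul_right_cancel₀ hx (by rw [← h', one_mul])
      left; rw [this, one_smul]
    · have : c = -1 := mul_right_cancel₀ hx (by rw [neg_one_mul, ← neg_eq_iff_eq_neg.2 h'])
      right; rw [this, neg_smul, one_smul, neg_neg]

end Counting

/-! ### Matrix relations and the number of vertices -/

section Relations

variable {p : ℕ} [Fact p.Prime]

open Classical in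
theorem adjMatrix_mul_all (hp : Odd p) :
    (graph' p).adjMatrix ℝ * relMatrix (fun _ _ => True) =
      ((p : ℝ) - 1) • relMatrix (fun _ _ => True) := by
  ext x y
  rw [adjMatrix_mul_relMatrix hp]
  have h1 : 1 ≤ p := (Fact.out : p.Prime).one_le
  simp [relMatrix, Nat.totient_prime Fact.out, Nat.cast_sub h1]

open Classical in
theorem adjMatrix_mul_parallel (hp : Odd p) :
    (graph' p).adjMatrix ℝ * relMatrix Parallel =
      relMatrix (fun _ _ => True) - relMatrix Parallel := by
  ext x y
  rw [adjMatrix_mul_relMatrix hp]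
  have hq : (rep y.1).2 / (rep x.1).2 ≠ 0 := div_ne_zero (rep_snd_ne_zero y) (rep_snd_ne_zero x)
  simp only [parallel_neighbour]
  by_cases h : pairing (rep x.1) (rep y.1) = 0
  · simp [relMatrix, Parallel, h, hq.symm]
  · simp only [← eq_div_iff h]
    rw [card_units_filter_eq]
    simp [relMatrix, Parallel, h, rep_snd_ne_zero]

open Classical in
theorem adjMatrix_mul_sameHeight (hp : Odd p) :
    (graph' p).adjMatrix ℝ * relMatrix SameHeight = (2 : ℝ) • relMatrix (fun _ _ => True) := by
  ext x y
  rw [adjMatrix_mul_relMatrix hp]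
  have hq : (rep y.1).2 / (rep x.1).2 ≠ 0 := div_ne_zero (rep_snd_ne_zero y) (rep_snd_ne_zero x)
  simp only [sameHeight_neighbour]
  rw [card_units_filter_or (ne_neg_of_ne_zero hp hq)]
  simp [relMatrix, rep_snd_ne_zero]

open Classical in
theorem adjMatrix_eq_relMatrix : (graph' p).adjMatrix ℝ = relMatrix (graph' p).Adj := by
  ext x y
  simp [relMatrix, SimpleGraph.adjMatrix_apply]

open Classical in
-- With `q` the ratio of heights, common neighbours are the units `s` with `s * pairing x y = q ±
-- 1`. For parallel vertices all `p - 1` units work if `q = ±1` and none otherwise. For the others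
-- there are two solutions, one of which is the excluded `s = 0` exactly when `q = ±1`.
theorem adjMatrix_mul_adjMatrix (hp : Odd p) :
    (graph' p).adjMatrix ℝ * (graph' p).adjMatrix ℝ =
      (p : ℝ) • 1 + (2 : ℝ) • relMatrix (fun _ _ => True) - (2 : ℝ) • relMatrix Parallel
        - relMatrix SameHeight := by
  ext x y
  have hA := adjMatrix_mul_relMatrix hp (graph' p).Adj x y
  rw [← adjMatrix_eq_relMatrix] at hA
  refine hA.trans ?_
  simp only [adj'_neighbour]
  have h1 : 1 ≤ p := (Fact.out : p.Prime).one_le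
  have hx := rep_snd_ne_zero x
  have h2 := two_ne_zero_of_odd hp
  have hxy : SameHeight x y ↔
      (rep y.1).2 / (rep x.1).2 = 1 ∨ (rep y.1).2 / (rep x.1).2 = -1 := by
    rw [div_eq_iff hx, div_eq_iff hx]
    unfold SameHeight
    rw [one_mul, neg_one_mul, eq_comm, eq_comm (a := (rep y.1).2) (b := -_), neg_eq_iff_eq_neg]
  have hne : (1 : ZMod p) ≠ -1 := ne_neg_of_ne_zero hp one_ne_zero
  set q := (rep y.1).2 / (rep x.1).2
  have hone : (1 : Matrix (Vertex' p) (Vertex' p) ℝ) x y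
      = if Parallel x y ∧ SameHeight x y then 1 else 0 := by
    rw [Matrix.one_apply]
    exact if_congr eq_iff_parallel_and_sameHeight rfl rfl
  simp only [Matrix.sub_apply, Matrix.add_apply, Matrix.smul_apply, smul_eq_mul, hone, relMatrix,
    Matrix.of_apply, hxy]
  by_cases h : pairing (rep x.1) (rep y.1) = 0
  · have hK : Parallel x y := h
    simp only [h, mul_zero, hK, true_and, if_true]
    by_cases hq : q = 1 ∨ q = -1
    · have : ∀ s : (ZMod p)ˣ, 0 = q + 1 ∨ 0 = q - 1 := by
        intro s
        rcases hq with hq | hq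
        · right; rw [hq, sub_self]
        · left; rw [hq, neg_add_cancel]
      rw [filter_true_of_mem fun s _ => this s]
      simp [hq, Nat.totient_prime Fact.out, Nat.cast_sub h1]
    · have : ∀ s : (ZMod p)ˣ, ¬ (0 = q + 1 ∨ 0 = q - 1) := by
        rintro s (h | h)
        · exact hq (.inr (by linear_combination -h))
        · exact hq (.inl (by linear_combination -h))
      rw [filter_false_of_mem fun s _ => this s]
      simp [hq]
  · have hK : ¬ Parallel x y := h
    simp only [← eq_div_iff h]
    rw [card_units_filter_or]
    · simp only [hK, div_eq_zero_iff, h, or_false, false_and, if_true, if_false]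
      simp only [add_eq_zero_iff_eq_neg, sub_eq_zero]
      by_cases hq : q = 1
      · simp [hq, hne]; norm_num
      · by_cases hq' : q = -1
        · simp [hq', hne.symm]; norm_num
        · simp [hq, hq']
    · intro h'
      rw [div_left_inj' h] at h'
      exact h2 (by linear_combination h')

/-- Each vertex has exactly two representatives among the `p * (p - 1)` vectors with nonzero second
coordinate. -/
theorem card_vertex' (hp : Odd p) : 2 * Fintype.card (Vertex' p) = p * (p - 1) := by
  classical
  have h := card_eq_sum_card_fiberwise (s := (univ : Finset (ZMod p × (ZMod p)ˣ)))
    (f := fun v => mk' (v.1, (v.2 : ZMod p)) v.2.ne_zero) (t := univ) (by simp)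
  rw [card_univ, Fintype.card_prod, ZMod.card, ZMod.card_units] at h
  rw [h, mul_comm, ← smul_eq_mul, ← card_univ, ← sum_const]
  refine (sum_congr rfl fun x _ => ?_)
  symm
  have hx := rep_snd_ne_zero x
  rw [card_eq_two]
  refine ⟨((rep x.1).1, Units.mk0 _ hx), (-(rep x.1).1, -Units.mk0 _ hx), ?_, ?_⟩
  · intro h
    have := congrArg (fun v => (v.2 : ZMod p)) h
    exact ne_neg_of_ne_zero hp hx (by simpa using this)
  · ext ⟨a, b⟩
    rw [mem_filter, mem_insert, mem_singleton]
    conv_lhs => rw [← mk'_rep x]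
    rw [mk'_eq_mk']
    simp [Prod.ext_iff, Units.ext_iff]

end Relations

/-! ### The explicit spectral projections -/

section Resolution

variable {V : Type*} [DecidableEq V]

/-- The eigenvalues of the modified Platonic graph, in increasing order, in terms of `r = √p`. -/
def eigenvalues (r : ℝ) : Fin 5 → ℝ := ![-r, -1, 0, r, r ^ 2 - 1]

/-- The tight inequality is `r < r ^ 2 - 1`, true above the golden ratio; `17 / 10` lies between
that and `√3`. -/
theorem eigenvalues_strictMono {r : ℝ} (hr : 17 / 10 < r) : StrictMono (eigenvalues r) := by
  rw [Fin.strictMono_iff_lt_succ]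
  intro i
  fin_cases i <;> simp [eigenvalues] <;> nlinarith

/-- The candidate for the orthogonal projections onto the eigenspaces of `A`. -/
noncomputable def projections (r : ℝ) (A J K C : Matrix V V ℝ) : Fin 5 → Matrix V V ℝ :=
  -- A line has `m` vertices and a height has `r ^ 2 = p`, which gives the averaging factors. `R` is
  -- the complement of functions of the line plus functions of the height, and `B = A * R`; since `A
  -- ^ 2 = p` there, the last two projections are `(R ± B / r) / 2`.
  let m : ℝ := (r ^ 2 - 1) / 2
  let R : Matrix V V ℝ := 1 - m⁻¹ • K - (r ^ 2)⁻¹ • C + (r ^ 2 * m)⁻¹ • J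
  let B : Matrix V V ℝ := A + m⁻¹ • K - m⁻¹ • J
  ![(2 : ℝ)⁻¹ • R - (2 * r)⁻¹ • B, m⁻¹ • K - (r ^ 2 * m)⁻¹ • J, (r ^ 2)⁻¹ • C - (r ^ 2 * m)⁻¹ • J,
    (2 : ℝ)⁻¹ • R + (2 * r)⁻¹ • B, (r ^ 2 * m)⁻¹ • J]

variable {r : ℝ} {A J K C : Matrix V V ℝ}

theorem sum_projections : ∑ i, projections r A J K C i = 1 := by
  simp only [Fin.sum_univ_five, projections, Matrix.cons_val]
  module

theorem mul_projections [Fintype V] (hr : 17 / 10 < r) (hJ : A * J = (r ^ 2 - 1) • J) (hK : A * K = J - K)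
    (hC : A * C = (2 : ℝ) • J)
    (hA : A * A = (r ^ 2) • 1 + (2 : ℝ) • J - (2 : ℝ) • K - C) (i : Fin 5) :
    A * projections r A J K C i = eigenvalues r i • projections r A J K C i := by
  have hr0 : r ≠ 0 := by linarith
  have hm : r ^ 2 - 1 ≠ 0 := by nlinarith
  fin_cases i <;>
  · simp only [projections, eigenvalues, Matrix.cons_val, Fin.zero_eta, Fin.mk_one,
      Fin.reduceFinMk, mul_add, mul_sub, Matrix.mul_smul, hJ, hK, hC, hA, mul_one]
    match_scalars <;> field_simp <;> ring

theorem transpose_projections (hA : A.transpose = A) (hJ : J.transpose = J) (hK : K.transpose = K)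
    (hC : C.transpose = C) (i : Fin 5) :
    (projections r A J K C i).transpose = projections r A J K C i := by
  fin_cases i <;> simp [projections, hA, hJ, hK, hC]

theorem projections_mul [Fintype V] (hr : 17 / 10 < r) (hJ : A * J = (r ^ 2 - 1) • J) (hK : A * K = J - K)
    (hC : A * C = (2 : ℝ) • J)
    (hA : A * A = (r ^ 2) • 1 + (2 : ℝ) • J - (2 : ℝ) • K - C) (hA' : A.transpose = A)
    (hJ' : J.transpose = J) (hK' : K.transpose = K) (hC' : C.transpose = C) (i : Fin 5) :
    projections r A J K C i * A = eigenvalues r i • projections r A J K C i := by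
  have h := congrArg Matrix.transpose (mul_projections hr hJ hK hC hA i)
  rwa [Matrix.transpose_mul, Matrix.transpose_smul, transpose_projections hA' hJ' hK' hC', hA'] at h

/-- The multiplicities of the eigenvalues in terms of `r = √p`. -/
noncomputable def multiplicities (r : ℝ) : Fin 5 → ℝ :=
  ![(r ^ 2 - 1) * (r ^ 2 - 3) / 4, r ^ 2 - 1, (r ^ 2 - 3) / 2, (r ^ 2 - 1) * (r ^ 2 - 3) / 4, 1]

theorem trace_projections [Fintype V] (hr : 17 / 10 < r) {n : ℝ} (hn : n = r ^ 2 * (r ^ 2 - 1) / 2)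
    (h1 : (1 : Matrix V V ℝ).trace = n) (hJ : J.trace = n) (hK : K.trace = n) (hC : C.trace = n)
    (hA : A.trace = 0) (i : Fin 5) :
    (projections r A J K C i).trace = multiplicities r i := by
  have hr0 : r ≠ 0 := by linarith
  have hm : r ^ 2 - 1 ≠ 0 := by nlinarith
  fin_cases i <;>
  · simp only [projections, multiplicities, Matrix.cons_val, Fin.zero_eta, Fin.mk_one,
      Fin.reduceFinMk, Matrix.trace_add, Matrix.trace_sub, Matrix.trace_smul, h1, hJ, hK, hC, hA,
      hn, smul_eq_mul]
    field_simp
    try ring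

end Resolution

/-! ### Spectrum and the Ramanujan bound -/

section Spectrum

variable {p : ℕ} [Fact p.Prime]

open Classical in
theorem transpose_relMatrix {V : Type*} {r : V → V → Prop} (h : ∀ x y, r x y → r y x) :
    (relMatrix r).transpose = relMatrix r := by
  ext x y
  simp only [relMatrix, Matrix.transpose_apply, Matrix.of_apply]
  exact if_congr ⟨h y x, h x y⟩ rfl rfl

theorem trace_relMatrix {V : Type*} [Fintype V] {r : V → V → Prop} (h : ∀ x, r x x) :
    (relMatrix r).trace = Fintype.card V := by
  simp [Matrix.trace, relMatrix, h]

theorem three_le_of_odd (hp : Odd p) : 3 ≤ p := by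
  have := (Fact.out : p.Prime).two_le
  obtain ⟨a, rfl⟩ := hp
  omega

theorem sqrt_gt (hp : Odd p) : 17 / 10 < √(p : ℝ) := by
  have : (3 : ℝ) ≤ p := by exact_mod_cast three_le_of_odd hp
  apply Real.lt_sqrt_of_sq_lt
  linarith

open Classical in
/-- The projections onto the eigenspaces of the modified Platonic graph. -/
noncomputable def graphProjections (p : ℕ) [Fact p.Prime] :
    Fin 5 → Matrix (Vertex' p) (Vertex' p) ℝ :=
  projections √(p : ℝ) ((graph' p).adjMatrix ℝ) (relMatrix fun _ _ => True) (relMatrix Parallel)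
    (relMatrix SameHeight)

open Classical in
theorem adjMatrix_mul_graphProjections (hp : Odd p) (i : Fin 5) :
    (graph' p).adjMatrix ℝ * graphProjections p i =
      eigenvalues √(p : ℝ) i • graphProjections p i := by
  have hs : √(p : ℝ) ^ 2 = p := Real.sq_sqrt (Nat.cast_nonneg p)
  refine mul_projections (sqrt_gt hp) ?_ (adjMatrix_mul_parallel hp) (adjMatrix_mul_sameHeight hp)
    ?_ i
  · rw [hs]; exact adjMatrix_mul_all hp
  · rw [hs]; exact adjMatrix_mul_adjMatrix hp

open Classical in
theorem graphProjections_mul_adjMatrix (hp : Odd p) (i : Fin 5) :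
    graphProjections p i * (graph' p).adjMatrix ℝ =
      eigenvalues √(p : ℝ) i • graphProjections p i := by
  have hs : √(p : ℝ) ^ 2 = p := Real.sq_sqrt (Nat.cast_nonneg p)
  refine projections_mul (sqrt_gt hp) ?_ (adjMatrix_mul_parallel hp) (adjMatrix_mul_sameHeight hp)
    ?_ (SimpleGraph.transpose_adjMatrix _) (transpose_relMatrix fun _ _ h => h)
    (transpose_relMatrix fun _ _ => parallel_symm)
    (transpose_relMatrix fun _ _ => sameHeight_symm) i
  · rw [hs]; exact adjMatrix_mul_all hp
  · rw [hs]; exact adjMatrix_mul_adjMatrix hp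

theorem trace_graphProjections (hp : Odd p) (i : Fin 5) :
    (graphProjections p i).trace = multiplicities √(p : ℝ) i := by
  classical
  have hs : √(p : ℝ) ^ 2 = p := Real.sq_sqrt (Nat.cast_nonneg p)
  refine trace_projections (n := Fintype.card (Vertex' p)) (sqrt_gt hp) ?_ (Matrix.trace_one)
    (trace_relMatrix fun _ => trivial) (trace_relMatrix fun _ => pairing_self _)
    (trace_relMatrix fun _ => .inl rfl) (SimpleGraph.trace_adjMatrix _ _) i
  rw [hs]
  have h1 : 1 ≤ p := (Fact.out : p.Prime).one_le
  have := congrArg (Nat.cast (R := ℝ)) (card_vertex' hp)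
  push_cast [Nat.cast_sub h1] at this
  linarith

theorem hasEigenvalue_graph' (hp : Odd p) {μ : ℝ}
    (hμ : (adjacencyOperator (graph' p)).HasEigenvalue μ) : ∃ i, μ = eigenvalues √(p : ℝ) i := by
  classical
  exact exists_eq_of_hasEigenvalue sum_projections (graphProjections_mul_adjMatrix hp) hμ

theorem multiplicity_graph' (hp : Odd p) (i : Fin 5) :
    (multiplicity (graph' p) (eigenvalues √(p : ℝ) i) : ℝ) = multiplicities √(p : ℝ) i := by
  classical
  rw [← trace_graphProjections hp]
  exact finrank_eigenspace_eq_trace sum_projections (graphProjections_mul_adjMatrix hp)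
    (adjMatrix_mul_graphProjections hp) (eigenvalues_strictMono (sqrt_gt hp)).injective i

theorem eigenvalue_cases (hp : Odd p) {μ : ℝ}
    (hμ : (adjacencyOperator (graph' p)).HasEigenvalue μ) :
    μ = (p : ℝ) - 1 ∨ μ = -1 ∨ μ = 0 ∨ μ = √(p : ℝ) ∨ μ = -√(p : ℝ) := by
  obtain ⟨i, rfl⟩ := hasEigenvalue_graph' hp hμ
  fin_cases i <;> simp [eigenvalues]

theorem isRamanujan_graph' (hp : Odd p) : IsRamanujan (graph' p) (p - 1) := by
  have h3 := three_le_of_odd hp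
  have h3' : (3 : ℝ) ≤ p := by exact_mod_cast h3
  refine ⟨?_, isRegular_graph' hp, fun μ hμ hne => ?_⟩
  · refine (SimpleGraph.connected_iff _).2 ⟨fun x y => ?_, ⟨mk' (0, 1) one_ne_zero⟩⟩
    obtain ⟨w, -⟩ := exists_walk' hp x y
    exact w.reachable
  rw [Nat.cast_sub (by omega), Nat.cast_one] at hne ⊢
  have h1 : 1 ≤ √((p : ℝ) - 1 - 1) := Real.one_le_sqrt.2 (by linarith)
  -- After squaring this is `p ≤ 4 (p - 2)`, valid from `p = 3` on.
  have hroot : √(p : ℝ) ≤ 2 * √((p : ℝ) - 1 - 1) := by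
    rw [Real.sqrt_le_left (by linarith), mul_pow, Real.sq_sqrt (by linarith)]
    linarith
  rcases eigenvalue_cases hp hμ with rfl | rfl | rfl | rfl | rfl
  · exact absurd (abs_of_nonneg (by linarith)) hne
  · rw [abs_neg, abs_one]; linarith
  · rw [abs_zero]; linarith
  · rwa [abs_of_nonneg (Real.sqrt_nonneg _)]
  · rwa [abs_neg, abs_of_nonneg (Real.sqrt_nonneg _)]

end Spectrum

end Platonic

theorem theorem3 (p : ℕ) [Fact p.Prime] (hp : Odd p) :
    -- the diameters
    (p ≠ 3 → (Platonic.graph p).ediam = 3 ∧ (Platonic.graph' p).ediam = 3) ∧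
    (p = 3 → (Platonic.graph p).ediam = 1 ∧ (Platonic.graph' p).ediam = 1) ∧
    -- the vertex connectivities, which equal the valences
    (Platonic.IsRegular (Platonic.graph p) p ∧
      Platonic.vertexConnectivity (Platonic.graph p) = p) ∧
    (Platonic.IsRegular (Platonic.graph' p) (p - 1) ∧
      Platonic.vertexConnectivity (Platonic.graph' p) = p - 1) ∧
    -- the spectrum of the modified graph, with multiplicities
    (∀ μ : ℝ, (Platonic.adjacencyOperator (Platonic.graph' p)).HasEigenvalue μ →
      μ = (p : ℝ) - 1 ∨ μ = -1 ∨ μ = 0 ∨ μ = √(p : ℝ) ∨ μ = -√(p : ℝ)) ∧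
    Platonic.multiplicity (Platonic.graph' p) ((p : ℝ) - 1) = 1 ∧
    Platonic.multiplicity (Platonic.graph' p) (-1) = p - 1 ∧
    Platonic.multiplicity (Platonic.graph' p) 0 = (p - 3) / 2 ∧
    Platonic.multiplicity (Platonic.graph' p) (√(p : ℝ)) = (p - 1) * (p - 3) / 4 ∧
    Platonic.multiplicity (Platonic.graph' p) (-√(p : ℝ)) = (p - 1) * (p - 3) / 4 ∧
    -- the Ramanujan property
    Platonic.IsRamanujan (Platonic.graph' p) (p - 1) := by
  have hs : √(p : ℝ) ^ 2 = p := Real.sq_sqrt (Nat.cast_nonneg p)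
  have h3 := Platonic.three_le_of_odd hp
  -- Writing `p = 2 k + 3` makes every truncated subtraction and natural division in the
  -- multiplicities exact.
  obtain ⟨k, hk⟩ : ∃ k, p = 2 * k + 3 := by
    obtain ⟨a, ha⟩ := hp
    exact ⟨a - 1, by omega⟩
  have hk1 : p - 1 = 2 * (k + 1) := by omega
  have hk3 : p - 3 = 2 * k := by omega
  have hk2 : (p - 3) / 2 = k := by omega
  have hk4 : (p - 1) * (p - 3) / 4 = (k + 1) * k := by
    rw [hk1, hk3, show 2 * (k + 1) * (2 * k) = 4 * ((k + 1) * k) by ring,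
      Nat.mul_div_cancel_left _ (by norm_num)]
  have hkr : (p : ℝ) = 2 * k + 3 := by rw [hk]; push_cast; ring
  have hmult := Platonic.multiplicity_graph' hp
  simp only [Platonic.multiplicities, hs] at hmult
  refine ⟨fun h => ⟨Platonic.ediam_graph hp h, Platonic.ediam_graph' hp h⟩, ?_,
    ⟨Platonic.isRegular_graph hp, Platonic.vertexConnectivity_eq
      (Platonic.isVertexConnected_graph hp) (Platonic.isRegular_graph hp)⟩,
    ⟨Platonic.isRegular_graph' hp, Platonic.vertexConnectivity_eq
      (Platonic.isVertexConnected_graph' hp) (Platonic.isRegular_graph' hp)⟩,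
    fun μ hμ => Platonic.eigenvalue_cases hp hμ, ?_, ?_, ?_, ?_, ?_,
    Platonic.isRamanujan_graph' hp⟩
  · rintro rfl
    exact ⟨Platonic.ediam_graph_three, Platonic.ediam_graph'_three⟩
  · have h := hmult 4
    simp only [Platonic.eigenvalues, Matrix.cons_val, hs] at h
    exact_mod_cast h
  · have h := hmult 1
    simp only [Platonic.eigenvalues, Matrix.cons_val] at h
    rw [hk1, ← Nat.cast_inj (R := ℝ), h, hkr]
    push_cast
    ring
  · have h := hmult 2
    simp only [Platonic.eigenvalues, Matrix.cons_val] at h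
    rw [hk2, ← Nat.cast_inj (R := ℝ), h, hkr]
    ring
  · have h := hmult 3
    simp only [Platonic.eigenvalues, Matrix.cons_val] at h
    rw [hk4, ← Nat.cast_inj (R := ℝ), h, hkr]
    push_cast
    ring
  · have h := hmult 0
    simp only [Platonic.eigenvalues, Matrix.cons_val] at h
    rw [hk4, ← Nat.cast_inj (R := ℝ), h, hkr]
    push_cast
    ring
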